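/- Let $K$ be a field and let $n \ge 2$ be an integer. Let $K_0(\mathcal V_K)$ be the Grothendieck ring of varieties over $K$ (a variety being a separated scheme of finite type over $K$): the abelian group generated by the isomorphism classes $[X]$ of varieties, with the relations $[X]=[Y]+[X\smallsetminus Y]$ for $Y\subset X$ closed, and with the product $[X][Y]=[X\times_K Y]$. Let $\mathbb T=[\mathbb G_m]\in K_0(\mathcal V_K)$ be the class of the multiplicative group. For a finite connected graph $\Gamma$ with $m\ge 1$ edges (parallel edges allowed), let $\Psi_\Gamma(t)=\sum_{T}\prod_{e\notin E(T)}t_e$, the sum being over the spanning trees $T$ of $\Gamma$, and let $X_\Gamma=\{\Psi_\Gamma=0\}\subset\mathbb P^{m-1}_K$ be its graph hypersurface, i.e. the zero locus of $\Psi_\Gamma$ as a reduced closed subvariety. Let $\Gamma_n$ be the $n$-th banana graph, which has two vertices and $n$ parallel edges between them. Then in $K_0(\mathcal V_K)$ $$[X_{\Gamma_n}]=\frac{(1+\mathbb T)^n-1}{\mathbb T}-\frac{\mathbb T^n-(-1)^n}{\mathbb T+1}-n\,\mathbb T^{n-2},$$ where the two fractions stand for the polynomials with integer coefficients that result from the exact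 divisions of $(1+x)^n-1$ by $x$ and of $x^n-(-1)^n$ by $x+1$ in $\mathbb Z[x]$, evaluated at $x=\mathbb T$. -/

import Mathlib

open CategoryTheory MonoidalCategory AlgebraicGeometry

universe u

noncomputable section

/-! ### The Grothendieck ring of varieties over a field -/

/-- A variety over `K`: a separated scheme of finite type over `Spec K`. -/
def IsVariety (K : Type u) [Field K] : ObjectProperty (Over (Spec (CommRingCat.of K))) :=
  fun X => LocallyOfFiniteType X.hom ∧ QuasiCompact X.hom ∧ IsSeparated X.hom

/-- Varieties are closed under fibre products over `K`, and `Spec K` is a variety. -/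
instance isVariety_isMonoidal (K : Type u) [Field K] : (IsVariety K).IsMonoidal where
  prop_unit := by
    change LocallyOfFiniteType (𝟙 _) ∧ QuasiCompact (𝟙 _) ∧ IsSeparated (𝟙 _)
    exact ⟨inferInstance, inferInstance, inferInstance⟩
  prop_tensor := by
    rintro X Y ⟨hX1, hX2, hX3⟩ ⟨hY1, hY2, hY3⟩
    change LocallyOfFiniteType (Limits.pullback.fst X.hom Y.hom ≫ X.hom) ∧
      QuasiCompact (Limits.pullback.fst X.hom Y.hom ≫ X.hom) ∧
      IsSeparated (Limits.pullback.fst X.hom Y.hom ≫ X.hom)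
    exact ⟨inferInstance, inferInstance, inferInstance⟩

/-- The category of varieties over `K`; the monoidal product is the product `X ×_K Y`. -/
abbrev Variety (K : Type u) [Field K] := (IsVariety K).FullSubcategory

/-- The free abelian group on the isomorphism classes of varieties over `K`,
with the multiplication `[X] [Y] = [X ×_K Y]` extended bilinearly. -/
abbrev FreeVarietyRing (K : Type u) [Field K] := MonoidAlgebra ℤ (Skeleton (Variety K))

/-- The generator attached to the isomorphism class of `X`. -/
def freeClass {K : Type u} [Field K] (X : Variety K) : FreeVarietyRing K :=
  MonoidAlgebra.of ℤ (Skeleton (Variety K)) (toSkeleton X)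

/-- `Z` is a closed subvariety of `X` by means of `i`, and `U` is its open complement
by means of `j`. -/
structure IsClosedOpenDecomposition {K : Type u} [Field K] {X Z U : Variety K}
    (i : Z ⟶ X) (j : U ⟶ X) : Prop where
  isClosedImmersion : IsClosedImmersion i.hom.left
  isOpenImmersion : IsOpenImmersion j.hom.left
  range_eq : Set.range j.hom.left = (Set.range i.hom.left)ᶜ

/-- The ideal generated by the elements `[X] - ([Z] + [X ∖ Z])` for `Z` closed in `X`.
As these elements are stable under multiplication by a generator `[Y]`, it is
also the subgroup generated by them. -/
def scissorIdeal (K : Type u) [Field K] : Ideal (FreeVarietyRing K) :=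
  Ideal.span {r | ∃ (X Z U : Variety K) (i : Z ⟶ X) (j : U ⟶ X),
    IsClosedOpenDecomposition i j ∧ r = freeClass X - (freeClass Z + freeClass U)}

/-- The Grothendieck ring `K₀(𝒱_K)` of varieties over `K`. -/
abbrev GrothendieckRing (K : Type u) [Field K] := FreeVarietyRing K ⧸ scissorIdeal K

/-- The class `[X]` of a variety in the Grothendieck ring. -/
def varietyClass {K : Type u} [Field K] (X : Variety K) : GrothendieckRing K :=
  Ideal.Quotient.mk (scissorIdeal K) (freeClass X)

/-! ### The multiplicative group -/

/-- The multiplicative group `𝔾_m = Spec K[T, T⁻¹]` as a variety over `K`. -/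
def multiplicativeGroup (K : Type u) [Field K] : Variety K where
  obj := Over.mk (Spec.map (CommRingCat.ofHom (algebraMap K (LaurentPolynomial K))))
  property := by
    have hft : Algebra.FiniteType K (LaurentPolynomial K) :=
      inferInstanceAs (Algebra.FiniteType K (AddMonoidAlgebra K ℤ))
    refine ⟨?_, inferInstanceAs (QuasiCompact (Spec.map _)),
      inferInstanceAs (IsSeparated (Spec.map _))⟩
    exact (HasRingHomProperty.Spec_iff (P := @LocallyOfFiniteType)).mpr
      ((RingHom.finiteType_algebraMap (A := K) (B := LaurentPolynomial K)).mpr hft)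

/-! ### Projective space and closed subvarieties -/

attribute [local instance] MvPolynomial.gradedAlgebra

/-- Projective space over `K` with homogeneous coordinates indexed by `σ`. -/
def projSpace (σ : Type) (K : Type u) [Field K] : Scheme.{u} :=
  Proj (MvPolynomial.homogeneousSubmodule σ K)

/-- The structure morphism of projective space. -/
def projSpaceToSpec (σ : Type) (K : Type u) [Field K] :
    projSpace σ K ⟶ Spec (CommRingCat.of K) :=
  Proj.toSpecZero (MvPolynomial.homogeneousSubmodule σ K) ≫
    Spec.map (CommRingCat.ofHom (algebraMap K (MvPolynomial.homogeneousSubmodule σ K 0)))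

theorem finiteType_over_degreeZero (σ : Type) [Finite σ] (K : Type u) [Field K] :
    Algebra.FiniteType (MvPolynomial.homogeneousSubmodule σ K 0) (MvPolynomial σ K) :=
  have : IsScalarTower K (MvPolynomial.homogeneousSubmodule σ K 0) (MvPolynomial σ K) :=
    ⟨fun a b c => smul_mul_assoc a (b : MvPolynomial σ K) c⟩
  Algebra.FiniteType.of_restrictScalars_finiteType K _ _

theorem finiteType_degreeZero (σ : Type) (K : Type u) [Field K] :
    (algebraMap K (MvPolynomial.homogeneousSubmodule σ K 0)).FiniteType := by
  refine RingHom.FiniteType.of_surjective _ ?_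
  rintro ⟨p, hp⟩
  refine ⟨p.coeff 0, Subtype.ext ?_⟩
  have h : p.totalDegree = 0 :=
    Nat.le_zero.mp (MvPolynomial.IsHomogeneous.totalDegree_le
      ((MvPolynomial.mem_homogeneousSubmodule 0 p).mp hp))
  exact (MvPolynomial.totalDegree_eq_zero_iff_eq_C.mp h).symm

theorem projSpaceToSpec_finiteType (σ : Type) [Finite σ] (K : Type u) [Field K] :
    LocallyOfFiniteType (projSpaceToSpec σ K) := by
  have := finiteType_over_degreeZero σ K
  have : LocallyOfFiniteType (Spec.map (CommRingCat.ofHom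
      (algebraMap K (MvPolynomial.homogeneousSubmodule σ K 0)))) :=
    (HasRingHomProperty.Spec_iff (P := @LocallyOfFiniteType)).mpr (finiteType_degreeZero σ K)
  have h := MorphismProperty.comp_mem @LocallyOfFiniteType
    (Proj.toSpecZero (MvPolynomial.homogeneousSubmodule σ K)) _ inferInstance this
  exact h

theorem projSpaceToSpec_quasiCompact (σ : Type) [Finite σ] (K : Type u) [Field K] :
    QuasiCompact (projSpaceToSpec σ K) := by
  have := finiteType_over_degreeZero σ K
  exact MorphismProperty.comp_mem @QuasiCompact
    (Proj.toSpecZero (MvPolynomial.homogeneousSubmodule σ K)) _ inferInstance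
    (inferInstanceAs (QuasiCompact (Spec.map _)))

theorem projSpaceToSpec_isSeparated (σ : Type) (K : Type u) [Field K] :
    IsSeparated (projSpaceToSpec σ K) :=
  MorphismProperty.comp_mem @IsSeparated
    (Proj.toSpecZero (MvPolynomial.homogeneousSubmodule σ K)) _ inferInstance
    (inferInstanceAs (IsSeparated (Spec.map _)))

/-- The closed subset `{F = 0}` of projective space. -/
def projZeroLocus {σ : Type} {K : Type u} [Field K] (F : MvPolynomial σ K) :
    TopologicalSpace.Closeds (projSpace σ K) where
  carrier := ProjectiveSpectrum.zeroLocus (MvPolynomial.homogeneousSubmodule σ K) {F}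
  isClosed' := ProjectiveSpectrum.isClosed_zeroLocus _ _

/-- The zero locus `{F = 0}` in projective space, as a (reduced) closed subvariety. -/
def projHypersurface {σ : Type} [Finite σ] {K : Type u} [Field K] (F : MvPolynomial σ K) :
    Variety K where
  obj := Over.mk ((Scheme.IdealSheafData.vanishingIdeal (projZeroLocus F)).subschemeι ≫
    projSpaceToSpec σ K)
  property := by
    have := projSpaceToSpec_finiteType σ K
    have := projSpaceToSpec_quasiCompact σ K
    have := projSpaceToSpec_isSeparated σ K
    exact ⟨inferInstanceAs (LocallyOfFiniteType (_ ≫ _)),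
      inferInstanceAs (QuasiCompact (_ ≫ _)), inferInstanceAs (IsSeparated (_ ≫ _))⟩

/-! ### Graph polynomials and graph hypersurfaces -/

open scoped Graph

/-- A set `T` of edges of a multigraph `G` is (the edge set of) a spanning tree if the subgraph
with all vertices of `G` and with edge set `T` is a tree: it has no loops, no parallel
edges, and it is a tree as a simple graph. -/
def IsSpanningTree {α β : Type} (G : Graph α β) (T : Set E(G)) : Prop :=
  (G.restrict (Subtype.val '' T)).Simple ∧
    (G.restrict (Subtype.val '' T)).toSimpleGraph.IsTree

open scoped Classical in
/-- The Kirchhoff polynomial `Ψ_G(t) = ∑_T ∏_{e ∉ T} t_e`, where `T` runs over the spanning trees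
of `G`. -/
def kirchhoffPolynomial {α β : Type} (G : Graph α β) [Fintype E(G)] (K : Type u) [Field K] :
    MvPolynomial E(G) K :=
  ∑ T ∈ Finset.univ.filter (fun T : Finset E(G) => IsSpanningTree G (T : Set E(G))), ∏ e ∈ Tᶜ, MvPolynomial.X e

/-- The graph hypersurface `X_G = {Ψ_G = 0}` in the projective space with one homogeneous
coordinate for each edge of `G`. -/
def graphHypersurface {α β : Type} (G : Graph α β) [Fintype E(G)] (K : Type u) [Field K] :
    Variety K :=
  projHypersurface (kirchhoffPolynomial G K)

/-- The banana graph `Γ_n`: two vertices and `n` parallel edges between them. -/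
abbrev bananaGraph (n : ℕ) : Graph (Fin 2) (Fin n) := Graph.banana 0 1 Set.univ

instance bananaGraph_fintype (n : ℕ) : Fintype E(bananaGraph n) :=
  inferInstanceAs (Fintype (Set.univ : Set (Fin n)))

end

/-!
The proof cuts the hypersurface `e_{n-1}(t_1, …, t_n) = 0` of the banana graph into affine pieces.

Two facts about classes do all the geometry. First, closed subschemes with the same underlying set
have the same class (`schemeClass_eq_of_range_eq`), because their intersection is a closed
subscheme of both with empty complement; so only zero loci matter, and nilpotents can be ignored.
Second, for elements `f`, `p` of a finitely generated algebra `A`, the hypersurface `X f + p = 0`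
in `Spec A × 𝔸¹` is a graph over `f ≠ 0` and a product with `𝔸¹` over `f = p = 0`, so that
`[X f + p = 0] = [Spec A] - [f = 0] + 𝕃 [f = p = 0]` with `𝕃 = 1 + 𝕋`
(`closedClass_X_mul_C_add_C`).

Write `p_m` for the product of `m` variables and `q_m` for the sum of the products of all of them
but one. Then `p_{m+1} = X p_m` and `q_{m+1} = p_m + X q_m`, and the second fact gives recursions
for the classes of `{p_m = 0}`, of `{p_m = q_m = 0}` and of `{p_m + q_m = 0}`; the last rests on
`p_{m+1} + q_{m+1} = X (p_m + q_m) + p_m`. Their solutions are `𝕃^m - 𝕋^m`,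
`𝕃^m - 𝕋^m - m 𝕋^{m-1}` and `𝕃^m - m 𝕋^{m-1} - (𝕋^{m+1} - (-1)^{m+1}) / (𝕋 + 1)`.

The spanning trees of the banana graph are its edges, so its polynomial is `q_n`. For a set `S` of
coordinates, let `Z_S` be the part of `q_n = 0` where the coordinates in `S` vanish. For `k ∉ S` the
complement of `Z_{S ∪ {k}}` in `Z_S` lies in the affine chart `t_k = 1`, where it is the affine
hypersurface of the dehomogenized polynomial (`projClass_coordSection`). In the remaining `m`
variables this polynomial is `p_m + q_m` for `S = ∅`, it is `p_m` if `S` has one element, and it is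
`0` if `S` has more. Adding up the pieces along a chain of sets `S`, with the affine spaces in the
last case making up a projective space of dimension `n - 3`, gives the formula.
-/

open CategoryTheory MonoidalCategory AlgebraicGeometry

noncomputable section

attribute [local instance] MvPolynomial.gradedAlgebra

open scoped Graph

/-! ### Scissor relations for schemes over a field -/

/-- The class in the Grothendieck ring of a scheme given by its structure morphism to `Spec K`. -/
def schemeClass {K : Type u} [Field K] {X : Scheme.{u}} (x : X ⟶ Spec (CommRingCat.of K))
    [hx : LocallyOfFiniteType x] [hx' : QuasiCompact x] [hx'' : IsSeparated x] :
    GrothendieckRing K :=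
  varietyClass ⟨Over.mk x, hx, hx', hx''⟩

section Schemes

variable {K : Type u} [Field K] {X Y Z U V W : Scheme.{u}} {x : X ⟶ Spec (CommRingCat.of K)}
  {y : Y ⟶ Spec (CommRingCat.of K)} {z : Z ⟶ Spec (CommRingCat.of K)}
  {v : V ⟶ Spec (CommRingCat.of K)} {w : W ⟶ Spec (CommRingCat.of K)}
  {t : U ⟶ Spec (CommRingCat.of K)}
  [LocallyOfFiniteType y] [QuasiCompact y] [IsSeparated y]
  [LocallyOfFiniteType z] [QuasiCompact z] [IsSeparated z]
  [LocallyOfFiniteType t] [QuasiCompact t] [IsSeparated t]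
  [LocallyOfFiniteType v] [QuasiCompact v] [IsSeparated v]
  [LocallyOfFiniteType w] [QuasiCompact w] [IsSeparated w]

theorem varietyClass_eq_of_iso {X Y : Variety K} (e : X ≅ Y) : varietyClass X = varietyClass Y := by
  unfold varietyClass freeClass
  rw [show toSkeleton X = toSkeleton Y from Quotient.sound ⟨e⟩]

section

variable [LocallyOfFiniteType x] [QuasiCompact x] [IsSeparated x]

theorem schemeClass_eq_of_iso (e : X ≅ Y) (h : e.hom ≫ y = x) : schemeClass x = schemeClass y :=
  varietyClass_eq_of_iso ((IsVariety K).isoMk (Over.isoMk e h))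

theorem schemeClass_eq_add (i : Z ⟶ X) (j : U ⟶ X) [IsClosedImmersion i] [IsOpenImmersion j]
    (hi : i ≫ x = z) (hj : j ≫ x = t) (h : Set.range j = (Set.range i)ᶜ) :
    schemeClass x = schemeClass z + schemeClass t := by
  unfold schemeClass varietyClass
  rw [← map_add, Ideal.Quotient.mk_eq_mk_iff_sub_mem]
  let X' : Variety K := ⟨Over.mk x, ‹_›, ‹_›, ‹_›⟩
  let Z' : Variety K := ⟨Over.mk z, ‹_›, ‹_›, ‹_›⟩
  let U' : Variety K := ⟨Over.mk t, ‹_›, ‹_›, ‹_›⟩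
  let i' : Z' ⟶ X' := ObjectProperty.homMk (Over.homMk i hi)
  let j' : U' ⟶ X' := ObjectProperty.homMk (Over.homMk j hj)
  exact Ideal.subset_span ⟨X', Z', U', i', j', ⟨‹_›, ‹_›, h⟩, rfl⟩

theorem schemeClass_eq_zero [IsEmpty X] : schemeClass x = 0 := by
  have h := schemeClass_eq_add (𝟙 X) (𝟙 X) (Category.id_comp x) (Category.id_comp x)
    (Set.ext fun a => isEmptyElim a)
  simpa using h

/-- A surjective closed immersion does not change the class: the complement is empty. -/
theorem schemeClass_eq_of_surjective (i : Z ⟶ X) [IsClosedImmersion i]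
    (hi : i ≫ x = z) (h : Set.range i = Set.univ) : schemeClass z = schemeClass x := by
  have : QuasiCompact (Scheme.emptyTo X ≫ x) := inferInstance
  have : LocallyOfFiniteType (Scheme.emptyTo X ≫ x) := inferInstance
  have : IsSeparated (Scheme.emptyTo X ≫ x) := inferInstance
  have he : schemeClass (Scheme.emptyTo X ≫ x) = 0 := schemeClass_eq_zero
  rw [schemeClass_eq_add i (Scheme.emptyTo X) hi rfl
    (by rw [h, Set.compl_univ, Set.range_eq_empty_iff]; infer_instance), he, add_zero]

end

/-- Closed subschemes with the same underlying set have the same class: their intersection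
is a closed subscheme of both, with the same underlying set. -/
theorem schemeClass_eq_of_range_eq (i : Z ⟶ X) (j : W ⟶ X) [IsClosedImmersion i]
    [IsClosedImmersion j] (hi : i ≫ x = z) (hj : j ≫ x = w) (h : Set.range i = Set.range j) :
    schemeClass z = schemeClass w := by
  rw [← schemeClass_eq_of_surjective (Limits.pullback.fst i j) (x := z) rfl,
    ← schemeClass_eq_of_surjective (Limits.pullback.snd i j) (x := w)
      (z := Limits.pullback.fst i j ≫ z)]
  · rw [← hi, ← hj, Limits.pullback.condition_assoc]
  · rw [Scheme.Pullback.range_snd, h, Set.preimage_range]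
  · rw [Scheme.Pullback.range_fst, ← h, Set.preimage_range]

/-- The scissor relation for a closed subscheme `Z` of `X` when the two parts of `Z` are given
only up to their underlying sets: `W` is closed in `X`, and `V` is closed in an open
subscheme `U` of `X`. -/
theorem schemeClass_eq_add_of_range_eq (i : Z ⟶ X) (k : W ⟶ X) (j : U ⟶ X) (l : V ⟶ U)
    [IsClosedImmersion i] [IsClosedImmersion k] [IsOpenImmersion j] [IsClosedImmersion l]
    (hi : i ≫ x = z) (hk : k ≫ x = w) (hj : j ≫ x = t) (hl : l ≫ t = v)
    (hkr : Set.range k = Set.range i \ Set.range j) (hlr : Set.range l = j ⁻¹' Set.range i) :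
    schemeClass z = schemeClass w + schemeClass v := by
  rw [schemeClass_eq_add (Limits.pullback.fst i k) (Limits.pullback.snd j i) (x := z)
    (z := Limits.pullback.fst i k ≫ z) (t := Limits.pullback.fst j i ≫ t) rfl]
  · congr 1
    · refine schemeClass_eq_of_surjective (Limits.pullback.snd i k) ?_ ?_
      · rw [← hi, ← hk, Limits.pullback.condition_assoc]
      · rw [Scheme.Pullback.range_snd, Set.preimage_eq_univ_iff, hkr]
        exact Set.sdiff_subset
    · refine schemeClass_eq_of_range_eq (Limits.pullback.fst j i) l rfl hl ?_
      rw [Scheme.Pullback.range_fst, hlr]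
  · rw [← hi, ← hj, Limits.pullback.condition_assoc]
  · rw [Scheme.Pullback.range_snd, Scheme.Pullback.range_fst, hkr]
    ext a
    simp

end Schemes

/-! ### Classes of affine varieties -/

/-- The structure morphism of the affine scheme of a `K`-algebra. -/
def specHom (K A : Type u) [Field K] [CommRing A] [Algebra K A] :
    Spec (CommRingCat.of A) ⟶ Spec (CommRingCat.of K) :=
  Spec.map (CommRingCat.ofHom (algebraMap K A))

section Affine

variable (K : Type u) [Field K]

instance specHom_locallyOfFiniteType (A : Type u) [CommRing A] [Algebra K A]
    [h : Algebra.FiniteType K A] : LocallyOfFiniteType (specHom K A) :=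
  (HasRingHomProperty.Spec_iff (P := @LocallyOfFiniteType)).mpr
    ((RingHom.finiteType_algebraMap (A := K) (B := A)).mpr h)

instance specHom_quasiCompact (A : Type u) [CommRing A] [Algebra K A] :
    QuasiCompact (specHom K A) :=
  inferInstanceAs (QuasiCompact (Spec.map _))

instance specHom_isSeparated (A : Type u) [CommRing A] [Algebra K A] :
    IsSeparated (specHom K A) :=
  inferInstanceAs (IsSeparated (Spec.map _))

/-- The class of the affine variety `Spec A`, for a finitely generated `K`-algebra `A`. -/
def algClass (A : Type u) [CommRing A] [Algebra K A] [Algebra.FiniteType K A] :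
    GrothendieckRing K :=
  schemeClass (specHom K A)

variable {K} {A B C : Type u} [CommRing A] [CommRing B] [CommRing C]
  [Algebra K A] [Algebra K B] [Algebra K C]

theorem specMap_comp_specHom (φ : A →ₐ[K] B) :
    Spec.map (CommRingCat.ofHom φ.toRingHom) ≫ specHom K A = specHom K B := by
  rw [specHom, specHom, ← Spec.map_comp, ← CommRingCat.ofHom_comp]
  congr 2
  exact φ.comp_algebraMap

theorem range_specMap_of_surjective (φ : A →ₐ[K] B) (hφ : Function.Surjective φ) :
    Set.range (Spec.map (CommRingCat.ofHom φ.toRingHom)) =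
      PrimeSpectrum.zeroLocus (RingHom.ker φ : Set A) :=
  range_comap_of_surjective B φ.toRingHom hφ

theorem isClosedImmersion_specMap (φ : A →ₐ[K] B) (hφ : Function.Surjective φ) :
    IsClosedImmersion (Spec.map (CommRingCat.ofHom φ.toRingHom)) :=
  IsClosedImmersion.spec_of_surjective _ hφ

theorem ker_quotientMkₐ (I : Ideal A) : RingHom.ker (Ideal.Quotient.mkₐ K I) = I :=
  Ideal.ext fun _ => Ideal.Quotient.eq_zero_iff_mem

variable [Algebra.FiniteType K A] [Algebra.FiniteType K B] [Algebra.FiniteType K C]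

theorem algClass_congr (e : A ≃ₐ[K] B) : algClass K A = algClass K B := by
  refine schemeClass_eq_of_iso (Scheme.Spec.mapIso e.toRingEquiv.toCommRingCatIso.symm.op) ?_
  exact specMap_comp_specHom e.symm.toAlgHom

/-- The class of a closed subscheme of an affine variety depends only on its underlying set. -/
theorem algClass_eq_of_radical_eq {R : Type u} [CommRing R] [Algebra K R]
    (φ : R →ₐ[K] A) (ψ : R →ₐ[K] B)
    (hφ : Function.Surjective φ) (hψ : Function.Surjective ψ)
    (h : (RingHom.ker φ).radical = (RingHom.ker ψ).radical) : algClass K A = algClass K B := by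
  have := isClosedImmersion_specMap φ hφ
  have := isClosedImmersion_specMap ψ hψ
  refine schemeClass_eq_of_range_eq _ _ (specMap_comp_specHom φ) (specMap_comp_specHom ψ) ?_
  rw [range_specMap_of_surjective φ hφ, range_specMap_of_surjective ψ hψ,
    ← PrimeSpectrum.zeroLocus_radical, h, PrimeSpectrum.zeroLocus_radical]

/-- Cutting an affine variety along a function `f`: a closed part `f = 0` and an open part
`f ≠ 0`. -/
theorem algClass_eq_add (f : A) (φ : A →ₐ[K] B) (ψ : A →ₐ[K] C) (hφ : Function.Surjective φ)
    (hf : RingHom.ker φ = Ideal.span {f})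
    (hψ : letI := ψ.toRingHom.toAlgebra; IsLocalization.Away f C) :
    algClass K A = algClass K B + algClass K C := by
  have := isClosedImmersion_specMap φ hφ
  let := ψ.toRingHom.toAlgebra
  have : IsOpenImmersion (Spec.map (CommRingCat.ofHom ψ.toRingHom)) :=
    IsOpenImmersion.of_isLocalization (S := C) f
  refine schemeClass_eq_add _ _ (specMap_comp_specHom φ) (specMap_comp_specHom ψ) ?_
  rw [range_specMap_of_surjective φ hφ, hf, PrimeSpectrum.zeroLocus_span]
  refine (PrimeSpectrum.localization_away_comap_range C f).trans ?_
  exact PrimeSpectrum.basicOpen_eq_zeroLocus_compl f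

theorem algClass_eq_zero [Subsingleton A] : algClass K A = 0 := by
  have : IsEmpty (Spec (CommRingCat.of A)) := inferInstanceAs (IsEmpty (PrimeSpectrum A))
  exact schemeClass_eq_zero

variable (K) in
theorem algClass_self : algClass K K = 1 := by
  have h : freeClass (𝟙_ (Variety K)) = 1 := by
    unfold freeClass
    rw [← Skeleton.one_eq]
    exact map_one (MonoidAlgebra.of ℤ (Skeleton (Variety K)))
  have h' : varietyClass (𝟙_ (Variety K)) = 1 := by
    unfold varietyClass
    rw [h, map_one]
  have key (f : Spec (CommRingCat.of K) ⟶ Spec (CommRingCat.of K)) [LocallyOfFiniteType f]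
      [QuasiCompact f] [IsSeparated f] (hf : f = 𝟙 _) : schemeClass f = 1 := by
    subst hf
    exact h'
  exact key (specHom K K) (Spec.map_id _)

theorem algClass_mul (e : C ≃ₐ[K] TensorProduct K A B) :
    algClass K A * algClass K B = algClass K C := by
  have h (X Y : Variety K) : varietyClass X * varietyClass Y = varietyClass (X ⊗ Y) := by
    unfold varietyClass freeClass
    rw [Skeleton.toSkeleton_tensorObj, map_mul, map_mul]
  have := Algebra.FiniteType.equiv (inferInstanceAs (Algebra.FiniteType K C)) e
  rw [algClass_congr e]
  let V (D : Type u) [CommRing D] [Algebra K D] [Algebra.FiniteType K D] : Variety K :=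
    ⟨Over.mk (specHom K D), inferInstanceAs (LocallyOfFiniteType (specHom K D)),
      inferInstanceAs (QuasiCompact (specHom K D)), inferInstanceAs (IsSeparated (specHom K D))⟩
  refine (h (V A) (V B)).trans ?_
  let i : (V A ⊗ V B).obj ≅ (V (TensorProduct K A B)).obj :=
    Over.isoMk (pullbackSpecIso K A B) (pullbackSpecIso_hom_base K A B)
  exact varietyClass_eq_of_iso (Y := V (TensorProduct K A B)) ((IsVariety K).isoMk i)

theorem algClass_polynomial :
    algClass K (Polynomial A) = algClass K A * algClass K (Polynomial K) :=
  (algClass_mul (polyEquivTensor K A)).symm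

variable (K) in
theorem algClass_polynomial_self :
    algClass K (Polynomial K) = 1 + varietyClass (multiplicativeGroup K) := by
  have hft : Algebra.FiniteType K (LaurentPolynomial K) :=
    inferInstanceAs (Algebra.FiniteType K (AddMonoidAlgebra K ℤ))
  have h : algClass K (LaurentPolynomial K) = varietyClass (multiplicativeGroup K) := rfl
  rw [← h, ← algClass_self]
  refine algClass_eq_add (Polynomial.X : Polynomial K) (Polynomial.aeval (0 : K))
    Polynomial.toLaurentAlg ?_ ?_ (LaurentPolynomial.isLocalization (R := K))
  · exact fun a => ⟨Polynomial.C a, by simp⟩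
  · ext p
    rw [RingHom.mem_ker, Ideal.mem_span_singleton, Polynomial.X_dvd_iff,
      Polynomial.coeff_zero_eq_aeval_zero]

/-! ### Closed subsets of affine varieties -/

variable (K) in
/-- The class of the closed subscheme of `Spec A` defined by the ideal `I`. -/
def closedClass (I : Ideal A) : GrothendieckRing K := algClass K (A ⧸ I)

theorem closedClass_congr_radical {I J : Ideal A} (h : I.radical = J.radical) :
    closedClass K I = closedClass K J :=
  algClass_eq_of_radical_eq (Ideal.Quotient.mkₐ K I) (Ideal.Quotient.mkₐ K J)
    (Ideal.Quotient.mkₐ_surjective K I) (Ideal.Quotient.mkₐ_surjective K J)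
    (by rwa [ker_quotientMkₐ, ker_quotientMkₐ])

theorem closedClass_map {I : Ideal A} (φ : A →ₐ[K] B) (hφ : Function.Surjective φ) :
    closedClass K (I.map φ) = closedClass K (I ⊔ RingHom.ker φ) := by
  refine algClass_eq_of_radical_eq ((Ideal.Quotient.mkₐ K (I.map φ)).comp φ)
    (Ideal.Quotient.mkₐ K _) ((Ideal.Quotient.mkₐ_surjective K _).comp hφ)
    (Ideal.Quotient.mkₐ_surjective K _) ?_
  congr 1
  rw [ker_quotientMkₐ]
  ext a
  rw [RingHom.mem_ker, AlgHom.comp_apply, Ideal.Quotient.mkₐ_eq_mk, Ideal.Quotient.eq_zero_iff_mem,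
    ← Ideal.mem_comap, Ideal.comap_map_of_surjective _ hφ]
  rfl

theorem closedClass_bot : closedClass K (⊥ : Ideal A) = algClass K A :=
  algClass_congr (AlgEquiv.quotientBot K A)

theorem closedClass_top : closedClass K (⊤ : Ideal A) = 0 :=
  have := Ideal.Quotient.subsingleton_iff.mpr (rfl : (⊤ : Ideal A) = ⊤)
  algClass_eq_zero

theorem closedClass_equiv (e : A ≃ₐ[K] B) (I : Ideal A) :
    closedClass K (I.map (e : A →ₐ[K] B)) = closedClass K I := by
  rw [closedClass_map _ e.surjective]
  congr 1
  rw [sup_eq_left]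
  intro a ha
  have : a = 0 := e.injective (by simpa using ha)
  exact this ▸ I.zero_mem

end Affine

/-! ### Hypersurfaces that are linear in one variable -/

section Polynomial

open Polynomial

variable {K : Type u} [Field K] {A : Type u} [CommRing A] [Algebra K A]

/-- Where `f ≠ 0`, the hypersurface `X f + p = 0` in `Spec A × 𝔸¹` is the graph of `- p / f`:
inverting `f` in its coordinate ring gives the localization `A_f`. -/
theorem exists_localization_quotient_X_mul_C_add_C (f p : A) :
    ∃ ψ : A[X] ⧸ Ideal.span {(X : A[X]) * C f + C p} →ₐ[K] Localization.Away f,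
      letI := ψ.toRingHom.toAlgebra
      IsLocalization.Away (Ideal.Quotient.mk (Ideal.span {(X : A[X]) * C f + C p}) (C f))
        (Localization.Away f) := by
  set J := Ideal.span {(X : A[X]) * C f + C p} with hJ
  let u := IsLocalization.Away.invSelf (S := Localization.Away f) f
  have hu : algebraMap A (Localization.Away f) f * u = 1 := IsLocalization.Away.mul_invSelf f
  let ψ₀ : A[X] →ₐ[K] Localization.Away f :=
    AlgHom.restrictScalars K (aeval (- (algebraMap A (Localization.Away f) p * u)))
  have h₀ : ∀ a ∈ J, ψ₀ a = 0 := by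
    intro a ha
    obtain ⟨b, rfl⟩ := Ideal.mem_span_singleton.mp ha
    have : ψ₀ (X * C f + C p) = 0 := by
      simp only [ψ₀, AlgHom.restrictScalars_apply, map_add, map_mul, aeval_X, aeval_C]
      linear_combination (- algebraMap A (Localization.Away f) p) * hu
    rw [map_mul, this, zero_mul]
  let ψ : A[X] ⧸ J →ₐ[K] Localization.Away f := Ideal.Quotient.liftₐ J ψ₀ h₀
  have hψ (a : A) : ψ (Ideal.Quotient.mk J (C a)) = algebraMap A (Localization.Away f) a :=
    aeval_C _ _
  -- Modulo the equation of the hypersurface, `f X = - p`, so that powers of `f` clear `X`.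
  have key (b : A[X] ⧸ J) : ∃ (N : ℕ) (a : A),
      Ideal.Quotient.mk J (C f) ^ N * b = Ideal.Quotient.mk J (C a) := by
    obtain ⟨b, rfl⟩ := Ideal.Quotient.mk_surjective b
    induction b using Polynomial.induction_on' with
    | add b c hb hc =>
      obtain ⟨N, a, ha⟩ := hb
      obtain ⟨M, a', ha'⟩ := hc
      refine ⟨N + M, f ^ M * a + f ^ N * a', ?_⟩
      simp only [map_add, map_mul, map_pow, ← ha, ← ha']
      ring
    | monomial N a =>
      refine ⟨N, a * (-p) ^ N, ?_⟩
      have : Ideal.Quotient.mk J X * Ideal.Quotient.mk J (C f) = Ideal.Quotient.mk J (C (-p)) := by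
        rw [← map_mul, Ideal.Quotient.mk_eq_mk_iff_sub_mem, C_neg, sub_neg_eq_add]
        exact Ideal.subset_span rfl
      rw [← C_mul_X_pow_eq_monomial, map_mul, map_mul, map_pow, C_pow, map_mul, map_pow, ← this]
      ring
  refine ⟨ψ, ?_⟩
  let := ψ.toRingHom.toAlgebra
  refine (isLocalization_iff _ _).mpr ⟨?_, ?_, ?_⟩
  · rintro ⟨_, N, rfl⟩
    refine (map_pow (algebraMap (A[X] ⧸ J) (Localization.Away f)) _ _) ▸ IsUnit.pow N ?_
    exact (hψ f).symm ▸ IsLocalization.Away.algebraMap_isUnit f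
  · intro z
    obtain ⟨⟨a, ⟨_, N, rfl⟩⟩, h⟩ := IsLocalization.surj (Submonoid.powers f) z
    refine ⟨⟨Ideal.Quotient.mk J (C a), ⟨_, N, rfl⟩⟩, ?_⟩
    refine Eq.trans ?_ (h.trans (hψ a).symm)
    congr 1
    exact (map_pow ψ _ N).trans (by rw [hψ, ← map_pow])
  · intro b c hbc
    obtain ⟨N, a, ha⟩ := key (b - c)
    have h : algebraMap A (Localization.Away f) a = 0 := by
      rw [← hψ, ← ha, map_mul, map_sub, show ψ b = ψ c from hbc, sub_self, mul_zero]
    obtain ⟨⟨_, M, rfl⟩, hM⟩ := (IsLocalization.map_eq_zero_iff (Submonoid.powers f) _ _).mp h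
    refine ⟨⟨_, M + N, rfl⟩, ?_⟩
    rw [← sub_eq_zero, ← mul_sub]
    simp only [pow_add, mul_assoc, ha]
    rw [← map_pow, ← C_pow, ← map_mul, ← C_mul, hM, C_0, map_zero]

variable [Algebra.FiniteType K A]

theorem algClass_eq_closedClass_add_localization (f : A) :
    algClass K A = closedClass K (Ideal.span {f}) + algClass K (Localization.Away f) := by
  refine algClass_eq_add f (Ideal.Quotient.mkₐ K _)
    (IsScalarTower.toAlgHom K A (Localization.Away f)) (Ideal.Quotient.mkₐ_surjective K _)
    (ker_quotientMkₐ _) ?_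
  have h : (IsScalarTower.toAlgHom K A (Localization.Away f)).toRingHom.toAlgebra =
    (inferInstance : Algebra A (Localization.Away f)) := Algebra.algebra_ext _ _ fun _ => rfl
  rw [h]
  infer_instance

/-- The hypersurface `X f + p = 0` in `Spec A × 𝔸¹` is a graph over the locus `f ≠ 0` and
the product of `𝔸¹` with the locus `f = p = 0`. -/
theorem closedClass_X_mul_C_add_C (f p : A) :
    closedClass K (Ideal.span {(X : A[X]) * C f + C p}) =
      algClass K A - closedClass K (Ideal.span {f}) +
        closedClass K (Ideal.span {f, p}) * (1 + varietyClass (multiplicativeGroup K)) := by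
  obtain ⟨ψ, hψ⟩ := exists_localization_quotient_X_mul_C_add_C (K := K) f p
  let J := Ideal.span {(X : A[X]) * C f + C p}
  let I := Ideal.span {f, p}
  let φ₀ : A[X] →ₐ[K] (A ⧸ I)[X] := mapAlgHom (Ideal.Quotient.mkₐ K I)
  have hφ₀ : RingHom.ker φ₀ = I.map C := by
    refine (Polynomial.ker_mapRingHom (Ideal.Quotient.mk I)).trans ?_
    rw [Ideal.mk_ker]
  have hφ₀' : Function.Surjective φ₀ :=
    Polynomial.map_surjective _ Ideal.Quotient.mk_surjective
  have hIC : I.map C = Ideal.span {C f} ⊔ J := by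
    rw [Ideal.map_span, Set.image_pair, ← Ideal.span_union, Set.singleton_union]
    refine le_antisymm (Ideal.span_le.mpr ?_) (Ideal.span_le.mpr ?_)
    · rintro _ (rfl | rfl)
      · exact Ideal.subset_span (by simp)
      · exact Ideal.mem_span_pair.mpr ⟨-X, 1, by ring⟩
    · rintro _ (rfl | rfl)
      · exact Ideal.subset_span (by simp)
      · exact Ideal.mem_span_pair.mpr ⟨X, 1, by ring⟩
  have hJφ : ∀ a ∈ J, φ₀ a = 0 := fun a ha => by
    rw [← RingHom.mem_ker, hφ₀, hIC]
    exact Ideal.mem_sup_right ha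
  have h := algClass_eq_add (Ideal.Quotient.mk J (C f)) (Ideal.Quotient.liftₐ J φ₀ hJφ) ψ
    (Ideal.Quotient.lift_surjective_of_surjective J hJφ hφ₀') ?_ hψ
  · rw [algClass_polynomial, algClass_polynomial_self] at h
    change algClass K (A[X] ⧸ J) = _ + algClass K (A ⧸ I) * _
    rw [algClass_eq_closedClass_add_localization f, h]
    ring
  · ext b
    obtain ⟨b, rfl⟩ := Ideal.Quotient.mk_surjective b
    refine (RingHom.mem_ker (f := φ₀) (r := b)).symm.trans ?_
    rw [hφ₀, hIC, ← Set.image_singleton (f := Ideal.Quotient.mk J), ← Ideal.map_span,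
      ← Ideal.mem_comap, Ideal.comap_map_of_surjective _ Ideal.Quotient.mk_surjective,
      ← RingHom.ker_eq_comap_bot, Ideal.mk_ker]

end Polynomial

/-! ### The complement of the torus in affine space -/

section Coordinates

open MvPolynomial

variable (σ : Type) [Fintype σ] (K : Type u) [Field K]

/-- The product of all the variables. -/
def prodVars : MvPolynomial σ K := ∏ i, X i

open scoped Classical in
/-- The sum of the products of all the variables but one, i.e. the elementary symmetric
polynomial of degree `card σ - 1` (and `0` if there are no variables). -/
def coprodVars : MvPolynomial σ K := ∑ i, ∏ j ∈ {i}ᶜ, X j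

open scoped Classical in
theorem coprodVars_eq_sum_ite : coprodVars σ K = ∑ i, ∏ j, if j = i then 1 else X j := by
  refine Finset.sum_congr rfl fun i _ => ?_
  rw [Finset.prod_ite, Finset.prod_const_one, one_mul]
  congr 1
  ext
  simp

theorem finSuccEquiv_prodVars (m : ℕ) : finSuccEquiv K m (prodVars (Fin (m + 1)) K) =
    Polynomial.X * Polynomial.C (prodVars (Fin m) K) := by
  simp only [prodVars, Fin.prod_univ_succ, map_mul, map_prod, finSuccEquiv_X_zero,
    finSuccEquiv_X_succ]

theorem finSuccEquiv_coprodVars (m : ℕ) : finSuccEquiv K m (coprodVars (Fin (m + 1)) K) =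
    Polynomial.C (prodVars (Fin m) K) + Polynomial.X * Polynomial.C (coprodVars (Fin m) K) := by
  simp only [coprodVars_eq_sum_ite, prodVars, Fin.sum_univ_succ, Fin.prod_univ_succ, map_add,
    map_sum, map_mul, map_prod, apply_ite (finSuccEquiv K m), finSuccEquiv_X_zero,
    finSuccEquiv_X_succ, map_one, Fin.succ_ne_zero, Fin.succ_inj, (Fin.succ_ne_zero _).symm,
    if_true, if_false, one_mul, Finset.mul_sum, apply_ite (Polynomial.C : _ → _)]

/-- The class of affine space. -/
theorem algClass_mvPolynomial (m : ℕ) : algClass K (MvPolynomial (Fin m) K) =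
    (1 + varietyClass (multiplicativeGroup K)) ^ m := by
  induction m with
  | zero => rw [algClass_congr (isEmptyAlgEquiv K (Fin 0)), algClass_self, pow_zero]
  | succ m ih =>
    rw [algClass_congr (finSuccEquiv K m), algClass_polynomial, algClass_polynomial_self, ih,
      pow_succ]

/-- The union of the coordinate hyperplanes is the complement of a torus. -/
theorem closedClass_prodVars (m : ℕ) : closedClass K (Ideal.span {prodVars (Fin m) K}) =
    (1 + varietyClass (multiplicativeGroup K)) ^ m - varietyClass (multiplicativeGroup K) ^ m := by
  induction m with
  | zero =>
    rw [prodVars, Finset.univ_eq_empty, Finset.prod_empty, Ideal.span_singleton_one,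
      closedClass_top, pow_zero, pow_zero, sub_self]
  | succ m ih =>
    have h := closedClass_X_mul_C_add_C (K := K) (prodVars (Fin m) K) 0
    rw [Polynomial.C_0, add_zero, ← finSuccEquiv_prodVars, Ideal.span_pair_zero, ih,
      algClass_mvPolynomial] at h
    rw [← closedClass_equiv (finSuccEquiv K m), Ideal.map_span, Set.image_singleton]
    refine h.trans ?_
    ring

/-- The locus where at least two coordinates vanish: the complement of a torus and of `m`
tori of one dimension less. -/
theorem closedClass_prodVars_coprodVars (m : ℕ) :
    closedClass K (Ideal.span {prodVars (Fin m) K, coprodVars (Fin m) K}) =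
      (1 + varietyClass (multiplicativeGroup K)) ^ m - varietyClass (multiplicativeGroup K) ^ m
        - m * varietyClass (multiplicativeGroup K) ^ (m - 1) := by
  induction m with
  | zero =>
    have h : prodVars (Fin 0) K = 1 := by
      rw [prodVars, Finset.univ_eq_empty, Finset.prod_empty]
    rw [h, Ideal.eq_top_of_isUnit_mem (Ideal.span _) (Ideal.subset_span (by simp)) isUnit_one,
      closedClass_top]
    simp
  | succ m ih =>
    set p := prodVars (Fin m) K
    set q := coprodVars (Fin m) K
    rw [← closedClass_equiv (finSuccEquiv K m), Ideal.map_span, Set.image_pair]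
    change closedClass K (Ideal.span {finSuccEquiv K m _, finSuccEquiv K m _}) = _
    rw [finSuccEquiv_prodVars, finSuccEquiv_coprodVars]
    -- On `X p = p + X q = 0` the function `p` is nilpotent, as `p ^ 2 = p (p + X q) - (X p) q`.
    have h₁ : (Ideal.span {Polynomial.X * Polynomial.C p,
          Polynomial.C p + Polynomial.X * Polynomial.C q}).radical =
        (Ideal.span {Polynomial.C p, Polynomial.X * Polynomial.C q}).radical := by
      apply le_antisymm
      · refine Ideal.radical_mono (Ideal.span_le.mpr ?_)
        rintro _ (rfl | rfl)
        · exact Ideal.mem_span_pair.mpr ⟨Polynomial.X, 0, by ring⟩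
        · exact Ideal.mem_span_pair.mpr ⟨1, 1, by ring⟩
      · rw [Ideal.radical_le_radical_iff, Ideal.span_le]
        have hp : Polynomial.C p ∈ (Ideal.span {Polynomial.X * Polynomial.C p,
            Polynomial.C p + Polynomial.X * Polynomial.C q}).radical :=
          ⟨2, Ideal.mem_span_pair.mpr ⟨- Polynomial.C q, Polynomial.C p, by ring⟩⟩
        rintro _ (rfl | rfl)
        · exact hp
        · have h := Ideal.le_radical (Ideal.mem_span_pair.mpr ⟨0, 1, rfl⟩ :
            0 * (Polynomial.X * Polynomial.C p) +
              1 * (Polynomial.C p + Polynomial.X * Polynomial.C q) ∈ _)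
          exact (Ideal.add_mem_iff_right _ hp).mp (by simpa using h)
    -- The hypersurface `X q = 0` over the closed subscheme `p = 0`.
    let I := Ideal.span {p}
    let φ : Polynomial (MvPolynomial (Fin m) K) →ₐ[K] Polynomial (MvPolynomial (Fin m) K ⧸ I) :=
      Polynomial.mapAlgHom (Ideal.Quotient.mkₐ K I)
    have hφ : Function.Surjective φ := Polynomial.map_surjective _ Ideal.Quotient.mk_surjective
    have h₂ := closedClass_map (K := K) (A := Polynomial (MvPolynomial (Fin m) K))
      (B := Polynomial (MvPolynomial (Fin m) K ⧸ I))
      (I := Ideal.span {Polynomial.X * Polynomial.C q}) φ hφ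
    have h₃ : RingHom.ker φ = Ideal.span {Polynomial.C p} := by
      refine (Polynomial.ker_mapRingHom (Ideal.Quotient.mk I)).trans ?_
      rw [Ideal.mk_ker, Ideal.map_span, Set.image_singleton]
    rw [h₃, ← Ideal.span_union, Set.union_singleton, Ideal.map_span, Set.image_singleton] at h₂
    have h₄ : φ (Polynomial.X * Polynomial.C q) =
        Polynomial.X * Polynomial.C (Ideal.Quotient.mk I q) + Polynomial.C 0 := by
      simp [φ]
    have h₅ := closedClass_map (I := Ideal.span {q}) (Ideal.Quotient.mkₐ K I)
      (Ideal.Quotient.mkₐ_surjective K I)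
    rw [ker_quotientMkₐ, ← Ideal.span_union, Set.union_singleton, Ideal.map_span,
      Set.image_singleton] at h₅
    rw [closedClass_congr_radical h₁, ← h₂]
    change closedClass K (Ideal.span {φ _}) = _
    rw [h₄, closedClass_X_mul_C_add_C, Ideal.span_pair_zero]
    change closedClass K I - closedClass K (Ideal.span {Ideal.Quotient.mkₐ K I q}) +
      closedClass K (Ideal.span {Ideal.Quotient.mkₐ K I q}) * _ = _
    refine (congrArg (fun c => closedClass K I - c + c * _) (h₅.trans ih)).trans ?_
    rw [closedClass_prodVars, Nat.add_sub_cancel]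
    rcases m with _ | m
    · simp
    · rw [Nat.add_sub_cancel]
      push_cast
      ring

/-- The affine chart of the hypersurface `coprodVars = 0`. The sum evaluates
`(T ^ (m + 1) - (-1) ^ (m + 1)) / (T + 1)`. -/
theorem closedClass_prodVars_add_coprodVars (m : ℕ) :
    closedClass K (Ideal.span {prodVars (Fin m) K + coprodVars (Fin m) K}) =
      (1 + varietyClass (multiplicativeGroup K)) ^ m
        - m * varietyClass (multiplicativeGroup K) ^ (m - 1)
        - ∑ i ∈ Finset.range (m + 1),
            varietyClass (multiplicativeGroup K) ^ i * (-1) ^ (m - i) := by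
  induction m with
  | zero =>
    have h : prodVars (Fin 0) K + coprodVars (Fin 0) K = 1 := by
      simp [prodVars, coprodVars]
    rw [h, Ideal.span_singleton_one, closedClass_top]
    simp
  | succ m ih =>
    have h := closedClass_X_mul_C_add_C (K := K)
      (prodVars (Fin m) K + coprodVars (Fin m) K) (prodVars (Fin m) K)
    have h₁ : Ideal.span {prodVars (Fin m) K + coprodVars (Fin m) K, prodVars (Fin m) K} =
        Ideal.span {prodVars (Fin m) K, coprodVars (Fin m) K} := by
      rw [Ideal.span_pair_comm, add_comm]
      simp
    have h₂ : finSuccEquiv K m (prodVars (Fin (m + 1)) K + coprodVars (Fin (m + 1)) K) =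
        Polynomial.X * Polynomial.C (prodVars (Fin m) K + coprodVars (Fin m) K) +
          Polynomial.C (prodVars (Fin m) K) := by
      rw [map_add, finSuccEquiv_prodVars, finSuccEquiv_coprodVars, Polynomial.C_add]
      ring
    rw [← h₂, h₁, ih, closedClass_prodVars_coprodVars, algClass_mvPolynomial] at h
    rw [← closedClass_equiv (finSuccEquiv K m), Ideal.map_span, Set.image_singleton]
    refine h.trans ?_
    have h₃ : ∑ i ∈ Finset.range (m + 1), varietyClass (multiplicativeGroup K) ^ i *
          (-1) ^ (m + 1 - i) =
        - ∑ i ∈ Finset.range (m + 1), varietyClass (multiplicativeGroup K) ^ i *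
          (-1) ^ (m - i) := by
      rw [← Finset.sum_neg_distrib]
      refine Finset.sum_congr rfl fun i hi => ?_
      rw [Nat.succ_sub (Nat.lt_succ_iff.mp (Finset.mem_range.mp hi)), pow_succ]
      ring
    rw [Finset.sum_range_succ _ (m + 1), h₃, Nat.add_sub_cancel, Nat.sub_self]
    rcases m with _ | m
    · simp
    · rw [Nat.add_sub_cancel]
      push_cast
      ring

end Coordinates

/-! ### Affine charts of projective space -/

section Charts

open MvPolynomial HomogeneousLocalization

theorem eval₂_const_mul_of_isHomogeneous {σ R S : Type*} [CommSemiring R] [CommSemiring S]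
    {a : MvPolynomial σ R} {n : ℕ} (ha : a.IsHomogeneous n) (φ : R →+* S) (u : S) (x : σ → S) :
    eval₂ φ (fun j => u * x j) a = u ^ n * eval₂ φ x a := by
  rw [eval₂_eq, eval₂_eq, Finset.mul_sum]
  refine Finset.sum_congr rfl fun d hd => ?_
  have h : ∑ i ∈ d.support, d i = n := by
    rw [← Finsupp.degree_apply, Finsupp.degree_eq_weight_one]
    exact ha (mem_support_iff.mp hd)
  simp only [mul_pow]
  rw [Finset.prod_mul_distrib, Finset.prod_pow_eq_pow_sum, h]
  ring

variable {σ : Type} {K : Type u} [Field K]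

theorem X_mem_homogeneousSubmodule (k : σ) :
    (X k : MvPolynomial σ K) ∈ homogeneousSubmodule σ K 1 :=
  (mem_homogeneousSubmodule 1 _).mpr (isHomogeneous_X K k)

/-- The regular function `a / X_k ^ n` on the chart `X_k ≠ 0` of projective space, for `a`
homogeneous of degree `n`. -/
def chartFraction (k : σ) (n : ℕ) (a : MvPolynomial σ K) (ha : a.IsHomogeneous n) :
    Away (homogeneousSubmodule σ K) (X k : MvPolynomial σ K) :=
  Away.mk _ (X_mem_homogeneousSubmodule k) n a (by simpa using ha)

variable (K) in
/-- The coordinate function `X_j / X_k` on the chart `X_k ≠ 0` of projective space. -/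
def chartCoord (k j : σ) : Away (homogeneousSubmodule σ K) (X k : MvPolynomial σ K) :=
  chartFraction k 1 (X j) (isHomogeneous_X K j)

variable (K) in
/-- The inclusion of the constants in the functions on the chart `X_k ≠ 0`. -/
def chartC (k : σ) : K →+* Away (homogeneousSubmodule σ K) (X k : MvPolynomial σ K) :=
  (fromZeroRingHom (homogeneousSubmodule σ K) _).comp (algebraMap K (homogeneousSubmodule σ K 0))

theorem chartCoord_self (k : σ) : chartCoord K k k = 1 := by
  refine HomogeneousLocalization.val_injective _ ?_
  rw [chartCoord, chartFraction, Away.val_mk, HomogeneousLocalization.val_one]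
  rw [← Localization.mk_one, Localization.mk_eq_mk_iff, Localization.r_iff_exists]
  exact ⟨1, by simp⟩

theorem pow_mul_val_chartFraction (k : σ) (n : ℕ) (a : MvPolynomial σ K) (ha : a.IsHomogeneous n) :
    algebraMap (MvPolynomial σ K) (Localization.Away (X k : MvPolynomial σ K)) (X k) ^ n *
      (chartFraction k n a ha).val = algebraMap _ _ a := by
  change _ * Localization.mk a _ = _
  rw [← map_pow, ← Localization.mk_one_eq_algebraMap, Localization.mk_mul,
    ← Localization.mk_one_eq_algebraMap, Localization.mk_eq_mk_iff, Localization.r_iff_exists]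
  exact ⟨1, by simp⟩

/-- Dehomogenization: a homogeneous polynomial divided by a power of `X_k` is the same polynomial
in the functions `X_j / X_k`. -/
theorem chartFraction_eq_eval₂ (k : σ) (n : ℕ) (a : MvPolynomial σ K) (ha : a.IsHomogeneous n) :
    chartFraction k n a ha = eval₂ (chartC K k) (chartCoord K k) a := by
  let u := algebraMap (MvPolynomial σ K) (Localization.Away (X k : MvPolynomial σ K)) (X k)
  let ι := algebraMap (Away (homogeneousSubmodule σ K) (X k : MvPolynomial σ K))
    (Localization.Away (X k : MvPolynomial σ K))
  have hu : IsUnit u := IsLocalization.Away.algebraMap_isUnit _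
  refine HomogeneousLocalization.val_injective _ ((hu.pow n).mul_left_cancel ?_)
  refine (pow_mul_val_chartFraction k n a ha).trans ?_
  change _ = u ^ n * ι (eval₂ _ _ a)
  have h (j : σ) : u * ι (chartCoord K k j) =
      algebraMap (MvPolynomial σ K) (Localization.Away (X k : MvPolynomial σ K)) (X j) := by
    rw [← pow_mul_val_chartFraction k 1 (X j) (isHomogeneous_X K j), pow_one]
    rfl
  rw [hom_eval₂, ← eval₂_const_mul_of_isHomogeneous ha]
  simp only [h]
  have hC : ι.comp (chartC K k) = (algebraMap (MvPolynomial σ K) _).comp C := rfl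
  rw [hC]
  conv_lhs => rw [← eval₂_eta a, hom_eval₂]

/-- The restriction of functions from the chart `X_k ≠ 0` to the subspace parametrized by
coordinates `w` with `w k = 1`. -/
def chartEval (k : σ) {P : Type u} [CommRing P] [Algebra K P] (w : σ → P) (hw : w k = 1) :
    Away (homogeneousSubmodule σ K) (X k : MvPolynomial σ K) →+* P :=
  (IsLocalization.Away.lift (S := Localization.Away (X k : MvPolynomial σ K))
    (g := (aeval (R := K) w).toRingHom) (X k) (by simp [hw])).comp (algebraMap _ _)

theorem chartEval_chartFraction (k : σ) {P : Type u} [CommRing P] [Algebra K P] (w : σ → P)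
    (hw : w k = 1) (n : ℕ) (a : MvPolynomial σ K) (ha : a.IsHomogeneous n) :
    chartEval k w hw (chartFraction k n a ha) = aeval w a := by
  let ℓ := IsLocalization.Away.lift (S := Localization.Away (X k : MvPolynomial σ K))
    (g := (aeval (R := K) w).toRingHom) (X k) (by simp [hw])
  have hℓ (b : MvPolynomial σ K) : ℓ (algebraMap _ _ b) = aeval w b :=
    IsLocalization.Away.lift_eq _ _ b
  change ℓ (chartFraction k n a ha).val = _
  have h' := congrArg ℓ (pow_mul_val_chartFraction k n a ha)
  rwa [map_mul, map_pow, hℓ, hℓ, aeval_X, hw, one_pow, one_mul] at h'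

theorem chartEval_chartC (k : σ) {P : Type u} [CommRing P] [Algebra K P] (w : σ → P)
    (hw : w k = 1) (c : K) : chartEval k w hw (chartC K k c) = algebraMap K P c := by
  have h : chartC K k c = chartFraction k 0 (C c) (isHomogeneous_C σ c) := by
    rw [chartFraction_eq_eval₂, eval₂_C]
  rw [h, chartEval_chartFraction, aeval_C]

variable {S : Set σ} {k : σ} {τ : Type} {w : σ → MvPolynomial τ K} {e : τ → σ}

theorem chartEval_surjective (hk : w k = 1) (he : ∀ i, w (e i) = X i) :
    Function.Surjective (chartEval (K := K) k w hk) := by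
  intro p
  refine ⟨eval₂ (chartC K k) (fun i => chartCoord K k (e i)) p, ?_⟩
  rw [hom_eval₂]
  have h₁ : (chartEval (K := K) k w hk).comp (chartC K k) = C := RingHom.ext (chartEval_chartC k w hk)
  have h₂ (i : τ) : chartEval (K := K) k w hk (chartCoord K k (e i)) = X i := by
    rw [chartCoord, chartEval_chartFraction, aeval_X, he]
  simp only [h₁, h₂, eval₂_eta]

/-- The zero locus, in the chart `X_k ≠ 0`, of the coordinates indexed by `S` and of a homogeneous
polynomial `F` is the hypersurface defined by the dehomogenization of `F` in the affine
space on the remaining coordinates. -/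
theorem ker_chartEval_le_iff (hk : w k = 1) (hS : ∀ j ∈ S, w j = 0)
    (he : ∀ i, w (e i) = X i) (hcov : ∀ j, j = k ∨ j ∈ S ∨ ∃ i, e i = j) {F : MvPolynomial σ K}
    {d : ℕ} (hF : F.IsHomogeneous d)
    (𝔮 : Ideal (Away (homogeneousSubmodule σ K) (X k : MvPolynomial σ K))) :
    (Ideal.span {aeval w F}).comap (chartEval (K := K) k w hk) ≤ 𝔮 ↔
      chartFraction k d F hF ∈ 𝔮 ∧ ∀ j ∈ S, chartCoord K k j ∈ 𝔮 := by
  constructor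
  · refine fun h => ⟨h ?_, fun j hj => h ?_⟩
    · rw [Ideal.mem_comap, chartEval_chartFraction]
      exact Ideal.subset_span rfl
    · rw [Ideal.mem_comap, chartCoord, chartEval_chartFraction, aeval_X, hS j hj]
      exact Ideal.zero_mem _
  · rintro ⟨hF𝔮, hS𝔮⟩ b hb
    let s : MvPolynomial τ K →+* Away (homogeneousSubmodule σ K) (X k : MvPolynomial σ K) :=
      eval₂Hom (chartC K k) fun i => chartCoord K k (e i)
    -- Modulo `𝔮`, the functions `X_j / X_k` are determined by the remaining coordinates.
    have hs : (Ideal.Quotient.mk 𝔮).comp (eval₂Hom (chartC K k) (chartCoord K k)) =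
        ((Ideal.Quotient.mk 𝔮).comp s).comp (aeval w).toRingHom := by
      refine ringHom_ext (fun c => ?_) fun j => ?_
      · simp [s]
      · simp only [RingHom.comp_apply, eval₂Hom_X', AlgHom.toRingHom_eq_coe, RingHom.coe_coe,
          aeval_X]
        obtain rfl | hj | ⟨i, rfl⟩ := hcov j
        · rw [hk, map_one, chartCoord_self, map_one]
        · rw [hS j hj, map_zero, map_zero, Ideal.Quotient.eq_zero_iff_mem]
          exact hS𝔮 j hj
        · rw [he, eval₂Hom_X']
    have hmod (n : ℕ) (a : MvPolynomial σ K) (ha : a.IsHomogeneous n) :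
        Ideal.Quotient.mk 𝔮 (chartFraction k n a ha) = Ideal.Quotient.mk 𝔮 (s (aeval w a)) := by
      rw [chartFraction_eq_eval₂]
      exact RingHom.congr_fun hs a
    obtain ⟨n, a, ha, rfl⟩ := Away.mk_surjective _ (X_mem_homogeneousSubmodule k) b
    have ha' : a.IsHomogeneous n := by simpa using ha
    change chartFraction k n a ha' ∈ _ at hb ⊢
    rw [Ideal.mem_comap, chartEval_chartFraction] at hb
    obtain ⟨p, hp⟩ := Ideal.mem_span_singleton.mp hb
    rw [← Ideal.Quotient.eq_zero_iff_mem, hmod, hp, map_mul, map_mul, ← hmod d F hF,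
      Ideal.Quotient.eq_zero_iff_mem.mpr hF𝔮, zero_mul]

end Charts

/-! ### Stratification of projective hypersurfaces -/

section Strata

open MvPolynomial HomogeneousLocalization

variable {σ : Type} {K : Type u} [Field K]

/-- The open subset `F ≠ 0` of projective space. -/
def projOpen (F : MvPolynomial σ K) : (projSpace σ K).Opens :=
  Proj.basicOpen (homogeneousSubmodule σ K) F

/-- The closed subset of projective space where `F` and the coordinates indexed by `S` vanish. -/
def coordSection (S : Set σ) (F : MvPolynomial σ K) :
    TopologicalSpace.Closeds (projSpace σ K) where
  carrier := ProjectiveSpectrum.zeroLocus (homogeneousSubmodule σ K) (insert F (X '' S))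
  isClosed' := ProjectiveSpectrum.isClosed_zeroLocus _ _

theorem mem_coordSection {S : Set σ} {F : MvPolynomial σ K} (x : projSpace σ K) :
    x ∈ coordSection S F ↔ x ∉ projOpen F ∧
      ∀ j ∈ S, x ∉ projOpen (X j : MvPolynomial σ K) := by
  have h (G : MvPolynomial σ K) : x ∉ projOpen G ↔
      G ∈ (x : ProjectiveSpectrum (homogeneousSubmodule σ K)).asHomogeneousIdeal := not_not
  change (insert F (X '' S) : Set (MvPolynomial σ K)) ⊆ _ ↔ _
  simp only [Set.insert_subset_iff, Set.image_subset_iff, h]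
  rfl

theorem coordSection_insert {S : Set σ} {F : MvPolynomial σ K} (k : σ) :
    (coordSection (insert k S) F : Set (projSpace σ K)) =
      (coordSection S F : Set (projSpace σ K)) \ projOpen (X k : MvPolynomial σ K) := by
  ext x
  simp only [SetLike.mem_coe, mem_coordSection, Set.mem_sdiff, Set.forall_mem_insert]
  tauto

variable (K) in
/-- The open immersion of the chart `X_k ≠ 0`. -/
def chartι (k : σ) :
    Spec (CommRingCat.of (Away (homogeneousSubmodule σ K) (X k : MvPolynomial σ K))) ⟶
      projSpace σ K :=
  Proj.awayι (homogeneousSubmodule σ K) (X k) (X_mem_homogeneousSubmodule k) one_pos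

instance chartι_isOpenImmersion (k : σ) : IsOpenImmersion (chartι K k) :=
  inferInstanceAs (IsOpenImmersion (Proj.awayι _ _ _ _))

theorem range_chartι (k : σ) :
    Set.range (chartι K k) = (projOpen (X k : MvPolynomial σ K) : Set (projSpace σ K)) :=
  congrArg (fun U : (projSpace σ K).Opens => (U : Set (projSpace σ K)))
    (Proj.opensRange_awayι (homogeneousSubmodule σ K) (X k) (X_mem_homogeneousSubmodule k) one_pos)

theorem chartι_comp_projSpaceToSpec (k : σ) :
    chartι K k ≫ projSpaceToSpec σ K = Spec.map (CommRingCat.ofHom (chartC K k)) := by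
  exact (Proj.awayι_toSpecZero_assoc _ _ _ _ _).trans (Spec.map_comp _ _).symm

theorem chartι_mem_projOpen (k : σ) {d : ℕ} (hd : 0 < d) {F : MvPolynomial σ K}
    (hF : F.IsHomogeneous d)
    (x : Spec (CommRingCat.of (Away (homogeneousSubmodule σ K) (X k : MvPolynomial σ K)))) :
    chartι K k x ∈ projOpen F ↔
      chartFraction k d F hF ∉ x.asIdeal := by
  have h := Proj.awayι_preimage_basicOpen (homogeneousSubmodule σ K)
    (X_mem_homogeneousSubmodule k) one_pos ((mem_homogeneousSubmodule d F).mpr hF) hd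
  have h' : Away.isLocalizationElem (X_mem_homogeneousSubmodule (K := K) k)
      ((mem_homogeneousSubmodule d F).mpr hF) = chartFraction k d F hF := by
    refine HomogeneousLocalization.val_injective _ ?_
    rw [chartFraction, Away.val_mk, Away.val_mk, pow_one]
  rw [h'] at h
  exact Iff.of_eq (congrArg (x ∈ ·) h)

variable [Finite σ]

/-- The class of a closed subset of projective space, as a reduced closed subscheme. -/
def projClass (Z : TopologicalSpace.Closeds (projSpace σ K)) : GrothendieckRing K :=
  have := projSpaceToSpec_finiteType σ K
  have := projSpaceToSpec_quasiCompact σ K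
  have := projSpaceToSpec_isSeparated σ K
  schemeClass ((Scheme.IdealSheafData.vanishingIdeal Z).subschemeι ≫ projSpaceToSpec σ K)

/-- The stratum `X_k ≠ 0` of a hypersurface section is the affine hypersurface of the
dehomogenized polynomial. -/
theorem projClass_coordSection {S : Set σ} {k : σ} {m : ℕ} {w : σ → MvPolynomial (Fin m) K}
    {e : Fin m → σ} (hk : w k = 1) (hS : ∀ j ∈ S, w j = 0) (he : ∀ i, w (e i) = X i)
    (hcov : ∀ j, j = k ∨ j ∈ S ∨ ∃ i, e i = j) {F : MvPolynomial σ K} {d : ℕ} (hd : 0 < d)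
    (hF : F.IsHomogeneous d) :
    projClass (coordSection S F) =
      projClass (coordSection (insert k S) F) + closedClass K (Ideal.span {aeval w F}) := by
  have := projSpaceToSpec_finiteType σ K
  have := projSpaceToSpec_quasiCompact σ K
  have := projSpaceToSpec_isSeparated σ K
  have hc := chartι_comp_projSpaceToSpec (K := K) k
  have : LocallyOfFiniteType (Spec.map (CommRingCat.ofHom (chartC K k))) := by
    rw [← hc]
    infer_instance
  let π : Away (homogeneousSubmodule σ K) (X k : MvPolynomial σ K) →+*
      MvPolynomial (Fin m) K ⧸ Ideal.span {aeval w F} :=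
    (Ideal.Quotient.mk _).comp (chartEval k w hk)
  have hπ : Function.Surjective π :=
    Ideal.Quotient.mk_surjective.comp (chartEval_surjective hk he)
  have hπC : π.comp (chartC K k) = algebraMap K _ :=
    RingHom.ext fun c => congrArg (Ideal.Quotient.mk _) (chartEval_chartC k w hk c)
  have hker : RingHom.ker π = (Ideal.span {aeval w F}).comap (chartEval k w hk) := by
    rw [← RingHom.comap_ker, Ideal.mk_ker]
  have : IsClosedImmersion (Spec.map (CommRingCat.ofHom π)) :=
    IsClosedImmersion.spec_of_surjective _ hπ
  refine schemeClass_eq_add_of_range_eq (x := projSpaceToSpec σ K) _ _ (chartι K k)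
    (Spec.map (CommRingCat.ofHom π)) rfl rfl hc ?_ ?_ ?_
  · rw [← Spec.map_comp, ← CommRingCat.ofHom_comp, hπC]
    rfl
  · rw [Scheme.IdealSheafData.range_subschemeι, Scheme.IdealSheafData.range_subschemeι,
      Scheme.IdealSheafData.coe_support_vanishingIdeal,
      Scheme.IdealSheafData.coe_support_vanishingIdeal, coordSection_insert, range_chartι]
  · rw [Scheme.IdealSheafData.range_subschemeι, Scheme.IdealSheafData.coe_support_vanishingIdeal]
    refine (range_comap_of_surjective _ π hπ).trans ?_
    ext x
    rw [PrimeSpectrum.mem_zeroLocus, SetLike.coe_subset_coe, hker,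
      ker_chartEval_le_iff hk hS he hcov hF]
    refine Iff.trans ?_ (mem_coordSection (chartι K k x)).symm
    refine and_congr ?_ (forall₂_congr fun j _ => ?_)
    · exact (Iff.not (chartι_mem_projOpen k hd hF x)).trans not_not |>.symm
    · exact (Iff.not (chartι_mem_projOpen k one_pos (isHomogeneous_X K j) x)).trans not_not |>.symm

theorem projClass_coordSection_univ (F : MvPolynomial σ K) :
    projClass (coordSection Set.univ F) = 0 := by
  have h := Proj.iSup_basicOpen_eq_top' (homogeneousSubmodule σ K) (X : σ → MvPolynomial σ K)
    (fun i => ⟨1, X_mem_homogeneousSubmodule i⟩) (by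
      rw [eq_top_iff]
      intro p _
      induction p using MvPolynomial.induction_on with
      | C c =>
        exact Subalgebra.algebraMap_mem
          (Algebra.adjoin (homogeneousSubmodule σ K 0) (Set.range (X : σ → MvPolynomial σ K)))
          (⟨C c, (mem_homogeneousSubmodule 0 _).mpr (isHomogeneous_C σ c)⟩ :
            homogeneousSubmodule σ K 0)
      | add p q hp hq => exact add_mem (hp trivial) (hq trivial)
      | mul_X p i hp => exact mul_mem (hp trivial) (Algebra.subset_adjoin ⟨i, rfl⟩))
  have : IsEmpty (Scheme.IdealSheafData.vanishingIdeal
      (coordSection Set.univ F)).subscheme := by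
    refine ⟨fun y => ?_⟩
    have hy := Set.mem_range_self (f := (Scheme.IdealSheafData.vanishingIdeal
      (coordSection Set.univ F)).subschemeι) y
    rw [Scheme.IdealSheafData.range_subschemeι, Scheme.IdealSheafData.coe_support_vanishingIdeal,
      SetLike.mem_coe, mem_coordSection] at hy
    obtain ⟨i, hi⟩ := TopologicalSpace.Opens.mem_iSup.mp (h.ge (Set.mem_univ _))
    exact hy.2 i trivial hi
  have := projSpaceToSpec_finiteType σ K
  have := projSpaceToSpec_quasiCompact σ K
  have := projSpaceToSpec_isSeparated σ K
  exact schemeClass_eq_zero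

end Strata

/-! ### The hypersurface of the coordinate polynomial -/

section CoprodVars

open MvPolynomial

variable {σ : Type} [Fintype σ]

open scoped Classical in
theorem prod_eq_mul_prod_mul_prod_fin {M : Type*} [CommMonoid M] {S : Finset σ} {k : σ}
    (hkS : k ∉ S) {m : ℕ} (ε : Fin m ≃ ((insert k S)ᶜ : Finset σ)) (f : σ → M) :
    ∏ j, f j = f k * (∏ j ∈ S, f j) * ∏ i, f (ε i) := by
  rw [← Finset.prod_mul_prod_compl (insert k S) f, Finset.prod_insert hkS,
    ← Finset.prod_coe_sort (insert k S)ᶜ f, ← ε.prod_comp]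

open scoped Classical in
theorem sum_eq_add_sum_add_sum_fin {M : Type*} [AddCommMonoid M] {S : Finset σ} {k : σ}
    (hkS : k ∉ S) {m : ℕ} (ε : Fin m ≃ ((insert k S)ᶜ : Finset σ)) (f : σ → M) :
    ∑ j, f j = f k + (∑ j ∈ S, f j) + ∑ i, f (ε i) :=
  prod_eq_mul_prod_mul_prod_fin (M := Multiplicative M) hkS ε f

variable (K : Type u) [Field K]

open scoped Classical in
/-- Setting one variable equal to `1` and those indexed by `S` equal to `0` in `coprodVars`. -/
theorem aeval_coprodVars {S : Finset σ} {k : σ} (hkS : k ∉ S) {m : ℕ}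
    (ε : Fin m ≃ ((insert k S)ᶜ : Finset σ)) {w : σ → MvPolynomial (Fin m) K} (hk : w k = 1)
    (hS : ∀ j ∈ S, w j = 0) (he : ∀ i, w (ε i) = X i) :
    aeval w (coprodVars σ K) = 0 ^ S.card * (prodVars (Fin m) K + coprodVars (Fin m) K) +
      S.card * 0 ^ (S.card - 1) * prodVars (Fin m) K := by
  have hε (i : Fin m) : (ε i : σ) ≠ k ∧ (ε i : σ) ∉ S := by
    simpa [not_or] using (ε i).2
  have hterm (l : σ) : aeval w (∏ j, if j = l then 1 else X j : MvPolynomial σ K) =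
      (if k = l then 1 else 1) * (∏ j ∈ S, if j = l then 1 else 0) *
        ∏ i, if (ε i : σ) = l then 1 else X i := by
    rw [prod_eq_mul_prod_mul_prod_fin hkS ε]
    simp only [map_mul, map_prod, apply_ite (aeval w), map_one, aeval_X, hk, he]
    congr 2
    exact Finset.prod_congr rfl fun j hj => by rw [hS j hj]
  have h₁ : ∏ j ∈ S, (if j = k then 1 else 0 : MvPolynomial (Fin m) K) = 0 ^ S.card :=
    (Finset.prod_congr rfl fun j hj => if_neg (ne_of_mem_of_not_mem hj hkS)).trans
      (Finset.prod_const 0)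
  have h₂ (l : σ) (hl : l ∈ S) :
      ∏ j ∈ S, (if j = l then 1 else 0 : MvPolynomial (Fin m) K) = 0 ^ (S.card - 1) := by
    rw [← Finset.mul_prod_erase S _ hl, if_pos rfl, one_mul, ← Finset.card_erase_of_mem hl,
      ← Finset.prod_const]
    exact Finset.prod_congr rfl fun j hj => if_neg (Finset.ne_of_mem_erase hj)
  have h₃ (i : Fin m) :
      ∏ j ∈ S, (if j = ε i then 1 else 0 : MvPolynomial (Fin m) K) = 0 ^ S.card :=
    (Finset.prod_congr rfl fun j hj => if_neg (ne_of_mem_of_not_mem hj (hε i).2)).trans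
      (Finset.prod_const 0)
  have h₄ (l : σ) (hl : l ∈ insert k S) :
      ∏ i, (if (ε i : σ) = l then 1 else X i : MvPolynomial (Fin m) K) = prodVars (Fin m) K := by
    refine Finset.prod_congr rfl fun i _ => if_neg ?_
    rintro rfl
    exact Finset.mem_compl.mp (ε i).2 hl
  rw [coprodVars_eq_sum_ite, map_sum, sum_eq_add_sum_add_sum_fin hkS ε, hterm, h₁,
    h₄ k (Finset.mem_insert_self _ _),
    Finset.sum_congr rfl fun l hl => (hterm l).trans (by
      rw [h₂ l hl, h₄ l (Finset.mem_insert_of_mem hl)])]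
  simp only [hterm, h₃, ite_self, Subtype.val_inj, ε.injective.eq_iff, one_mul,
    Finset.sum_const, ← Finset.mul_sum, nsmul_eq_mul]
  rw [coprodVars_eq_sum_ite, mul_add, mul_assoc, add_right_comm]
  congr!

theorem isHomogeneous_coprodVars : (coprodVars σ K).IsHomogeneous (Fintype.card σ - 1) := by
  classical
  refine IsHomogeneous.sum _ _ _ fun i _ => ?_
  have h := IsHomogeneous.prod {i}ᶜ (fun j => X j : σ → MvPolynomial σ K) (fun _ => 1)
    fun j _ => isHomogeneous_X K j
  rw [Finset.sum_const, smul_eq_mul, mul_one, Finset.card_compl, Finset.card_singleton] at h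
  convert h

open scoped Classical in
/-- The recursion over coordinate subspaces: splitting off the locus where one more coordinate
does not vanish. -/
theorem projClass_coordSection_coprodVars (hσ : 2 ≤ Fintype.card σ) {S : Finset σ} {k : σ}
    (hkS : k ∉ S) {m : ℕ} (hm : S.card + 1 + m = Fintype.card σ) :
    projClass (coordSection S (coprodVars σ K)) =
      projClass (coordSection ((insert k S : Finset σ) : Set σ) (coprodVars σ K)) +
        closedClass K (Ideal.span {(0 ^ S.card * (prodVars (Fin m) K + coprodVars (Fin m) K) +
          S.card * 0 ^ (S.card - 1) * prodVars (Fin m) K : MvPolynomial (Fin m) K)}) := by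
  have hcard : ((insert k S)ᶜ : Finset σ).card = m := by
    rw [Finset.card_compl, Finset.card_insert_of_notMem hkS]
    omega
  let ε := (Finset.equivFinOfCardEq hcard).symm
  let w : σ → MvPolynomial (Fin m) K := fun j =>
    if h : j ∈ (insert k S)ᶜ then X (ε.symm ⟨j, h⟩) else if j = k then 1 else 0
  have hk : w k = 1 := by simp [w]
  have hS : ∀ j ∈ S, w j = 0 := fun j hj => by
    simp [w, hj, ne_of_mem_of_not_mem hj hkS]
  have he : ∀ i, w (ε i) = X i := fun i => by
    simp only [w]
    rw [dif_pos (ε i).2, Subtype.coe_eta, Equiv.symm_apply_apply]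
  have hcov : ∀ j, j = k ∨ j ∈ (S : Set σ) ∨ ∃ i, (ε i : σ) = j := fun j => by
    by_cases hj : j ∈ insert k S
    · exact (Finset.mem_insert.mp hj).imp_right Or.inl
    · exact Or.inr (Or.inr ⟨ε.symm ⟨j, Finset.mem_compl.mpr hj⟩, by simp⟩)
  rw [projClass_coordSection (e := fun i => (ε i : σ)) hk hS he hcov (by omega)
    (isHomogeneous_coprodVars K), aeval_coprodVars K hkS ε hk hS he, Finset.coe_insert]

open scoped Classical in
/-- Where two coordinates vanish, so does `coprodVars`: the class of a projective space. -/
theorem projClass_coordSection_of_two_le {S : Finset σ} (hS : 2 ≤ S.card) (r : ℕ)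
    (hr : S.card + r = Fintype.card σ) :
    projClass (coordSection S (coprodVars σ K)) =
      ∑ i ∈ Finset.range r, (1 + varietyClass (multiplicativeGroup K)) ^ i := by
  induction r generalizing S with
  | zero =>
    rw [(Finset.card_eq_iff_eq_univ S).mp hr, Finset.coe_univ, projClass_coordSection_univ,
      Finset.sum_range_zero]
  | succ r ih =>
    obtain ⟨k, hkS⟩ : ∃ k, k ∉ S := by
      by_contra! h
      rw [Finset.eq_univ_iff_forall.mpr h, Finset.card_univ] at hr
      omega
    have hcard := Finset.card_insert_of_notMem hkS
    rw [projClass_coordSection_coprodVars K (by omega) hkS (m := r) (by omega),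
      ih (by omega) (by omega), zero_pow (by omega), zero_pow (by omega), zero_mul, mul_zero,
      zero_mul, add_zero, Ideal.span_singleton_zero, closedClass_bot, algClass_mvPolynomial,
      Finset.sum_range_succ]

/-- The class of the projective hypersurface `coprodVars = 0` in `n` variables. -/
theorem varietyClass_projHypersurface_coprodVars {n : ℕ} (hn : 2 ≤ n)
    (hσ : Fintype.card σ = n) :
    varietyClass (projHypersurface (coprodVars σ K)) =
      ∑ i ∈ Finset.range n, (1 + varietyClass (multiplicativeGroup K)) ^ i -
        ∑ i ∈ Finset.range n, varietyClass (multiplicativeGroup K) ^ i * (-1) ^ (n - 1 - i) -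
        n * varietyClass (multiplicativeGroup K) ^ (n - 2) := by
  classical
  obtain ⟨k, l, hkl⟩ := Fintype.exists_pair_of_one_lt_card (α := σ) (by omega)
  obtain ⟨m, rfl⟩ := Nat.exists_eq_add_of_le' hn
  have h₀ : varietyClass (projHypersurface (coprodVars σ K)) =
      projClass (coordSection ((∅ : Finset σ) : Set σ) (coprodVars σ K)) := by
    have : coordSection ((∅ : Finset σ) : Set σ) (coprodVars σ K) =
        projZeroLocus (coprodVars σ K) := by
      refine TopologicalSpace.Closeds.ext ?_
      simp [coordSection, projZeroLocus]
    rw [this]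
    rfl
  rw [h₀, projClass_coordSection_coprodVars K (by omega) (Finset.notMem_empty k) (m := m + 1)
      (by rw [hσ, Finset.card_empty]; omega),
    projClass_coordSection_coprodVars K (S := insert k ∅) (k := l) (by omega)
      (by simpa using hkl.symm) (m := m) (by rw [hσ, insert_empty_eq, Finset.card_singleton]; omega),
    projClass_coordSection_of_two_le K (by simp [hkl.symm]) m
      (by rw [hσ]; simp [hkl.symm]; omega)]
  simp only [insert_empty_eq, Finset.card_singleton, Finset.card_empty, pow_zero, pow_one,
    Nat.sub_self, Nat.cast_zero, Nat.cast_one, zero_mul, add_zero, zero_add, one_mul]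
  rw [closedClass_prodVars, closedClass_prodVars_add_coprodVars,
    Finset.sum_range_succ (fun i => (1 + varietyClass (multiplicativeGroup K)) ^ i) (m + 1),
    Finset.sum_range_succ (fun i => (1 + varietyClass (multiplicativeGroup K)) ^ i) m]
  simp only [Nat.add_sub_cancel, show m + 2 - 1 = m + 1 from rfl, show m + 1 + 1 = m + 2 from rfl]
  push_cast
  ring

end CoprodVars

/-! ### Spanning trees of the banana graph -/

section Banana

open MvPolynomial

theorem isSpanningTree_bananaGraph_iff {n : ℕ} (T : Set E(bananaGraph n)) :
    IsSpanningTree (bananaGraph n) T ↔ ∃ e, T = {e} := by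
  set H := (bananaGraph n).restrict (Subtype.val '' T) with hH
  have hlink (e : Fin n) (x y : Fin 2) : H.IsLink e x y ↔
      e ∈ Subtype.val '' T ∧ ((x = 0 ∧ y = 1) ∨ (x = 1 ∧ y = 0)) := by
    simp [hH, Graph.restrict_isLink, Graph.banana_isLink]
  have hV : V(H) = Set.univ := by
    ext i
    fin_cases i <;> simp [hH]
  have hmem (e : E(bananaGraph n)) : e.1 ∈ Subtype.val '' T ↔ e ∈ T :=
    Subtype.val_injective.mem_set_image
  constructor
  · rintro ⟨hs, ht⟩
    have hne : T.Nonempty := by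
      -- A tree on two vertices has an edge.
      obtain ⟨p⟩ := ht.1.preconnected ⟨0, hV ▸ trivial⟩ ⟨1, hV ▸ trivial⟩
      cases p with
      | cons h _ =>
        obtain ⟨-, e, he⟩ := h
        obtain ⟨f, hf, -⟩ := ((hlink _ _ _).mp he).1
        exact ⟨f, hf⟩
    obtain ⟨e, he⟩ := hne
    refine ⟨e, Set.eq_singleton_iff_unique_mem.mpr ⟨he, fun f hf => Subtype.ext ?_⟩⟩
    exact hs.eq_of_isLink ((hlink _ 0 1).mpr ⟨(hmem f).mpr hf, Or.inl ⟨rfl, rfl⟩⟩)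
      ((hlink _ 0 1).mpr ⟨(hmem e).mpr he, Or.inl ⟨rfl, rfl⟩⟩)
  · rintro ⟨e, rfl⟩
    have hsimple : H.Simple := by
      refine { not_isLoopAt := fun f x hf => ?_, eq_of_isLink := fun f g x y hf hg => ?_ }
      · have := ((hlink f x x).mp hf).2
        omega
      · have hf' := ((hlink _ _ _).mp hf).1
        have hg' := ((hlink _ _ _).mp hg).1
        simp only [Set.image_singleton, Set.mem_singleton_iff] at hf' hg'
        rw [hf', hg']
    refine ⟨hsimple, ?_⟩
    have hadj : ∀ x y : V(H), x ≠ y → H.toSimpleGraph.Adj x y := by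
      intro x y hxy
      refine ⟨hxy, e.1, (hlink _ _ _).mpr ⟨by simp, ?_⟩⟩
      have := Subtype.coe_ne_coe.mpr hxy
      omega
    have : Nonempty V(H) := ⟨⟨0, hV ▸ trivial⟩⟩
    have hcard : ENat.card V(H) ≤ 2 := by
      rw [hV, ENat.card_congr (Equiv.Set.univ _), ENat.card_eq_coe_fintype_card, Fintype.card_fin]
      rfl
    refine ⟨⟨fun x y => ?_⟩, SimpleGraph.IsAcyclic.of_card_le_two hcard⟩
    obtain rfl | hxy := eq_or_ne x y
    · exact SimpleGraph.Reachable.refl x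
    · exact (hadj x y hxy).reachable

theorem card_edgeSet_bananaGraph (n : ℕ) : Fintype.card E(bananaGraph n) = n :=
  (Fintype.card_congr (Equiv.Set.univ (Fin n))).trans (Fintype.card_fin n)

theorem kirchhoffPolynomial_bananaGraph (n : ℕ) (K : Type u) [Field K] :
    kirchhoffPolynomial (bananaGraph n) K = coprodVars E(bananaGraph n) K := by
  classical
  rw [kirchhoffPolynomial, coprodVars]
  have h : Finset.univ.filter (fun T : Finset E(bananaGraph n) =>
      IsSpanningTree (bananaGraph n) (T : Set E(bananaGraph n))) =
      Finset.univ.map ⟨fun e => {e}, Finset.singleton_injective⟩ := by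
    ext T
    simp only [Finset.mem_filter, Finset.mem_univ, true_and, isSpanningTree_bananaGraph_iff,
      Finset.mem_map, Function.Embedding.coeFn_mk]
    refine exists_congr fun e => ?_
    rw [Finset.coe_eq_singleton]
    exact eq_comm
  rw [h, Finset.sum_map]
  refine Finset.sum_congr rfl fun e _ => Finset.prod_congr ?_ fun _ _ => rfl
  ext
  simp only [Function.Embedding.coeFn_mk, Finset.mem_compl]

end Banana

end

theorem mainTheorem2 (K : Type u) [Field K] (n : ℕ) (hn : 2 ≤ n) :
    ∃ P Q : Polynomial ℤ,
      Polynomial.X * P = (1 + Polynomial.X) ^ n - 1 ∧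
      (Polynomial.X + 1) * Q = Polynomial.X ^ n - (-1) ^ n ∧
      varietyClass (graphHypersurface (bananaGraph n) K) =
        Polynomial.aeval (varietyClass (multiplicativeGroup K)) P
          - Polynomial.aeval (varietyClass (multiplicativeGroup K)) Q
          - (n : GrothendieckRing K) * varietyClass (multiplicativeGroup K) ^ (n - 2) := by
  refine ⟨∑ i ∈ Finset.range n, (1 + Polynomial.X) ^ i,
    ∑ i ∈ Finset.range n, Polynomial.X ^ i * (-1) ^ (n - 1 - i), ?_, ?_, ?_⟩
  · rw [← mul_geom_sum, add_sub_cancel_left]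
  · rw [← (Commute.all Polynomial.X (-1 : Polynomial ℤ)).mul_geom_sum₂, sub_neg_eq_add]
  · rw [graphHypersurface, kirchhoffPolynomial_bananaGraph,
      varietyClass_projHypersurface_coprodVars K hn (card_edgeSet_bananaGraph n)]
    simp
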